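/- A $(0,1)$-matrix is called lonesum if no other $(0,1)$-matrix of the same size has the same row sum vector and the same column sum vector. A $(0,1)$-matrix $A$ is called lonesum decomposable if some permutation of its rows and columns turns it into a block diagonal matrix $\mathrm{diag}(L_1,\dots,L_r)$ whose diagonal blocks $L_i$ are lonesum. A Ferrers matrix is a $(0,1)$-matrix $(a_{ij})$ such that $a_{ij}=0$ implies $a_{i'j}=0$ for all $i'\ge i$ and $a_{ij'}=0$ for all $j'\ge j$. Every lonesum decomposable matrix can be turned, by permuting rows and columns, into a block diagonal matrix $\mathrm{diag}(F_1,\dots,F_k,O)$, where $F_1,\dots,F_k$ are non-empty Ferrers matrices without zero rows or zero columns and $O$ is a (possibly empty) zero matrix; the number $k$ is uniquely determined and is called the decomposition order of the matrix. Let $D_k(m,n)$ denote the number of $m\times n$ lonesum decomposable matrices of decomposition order $k$. **Theorem 4.3.** Let $k, m, m', n, n'$ be positive integers and let $p$ be a prime. Then: (i) If $k\ge p$, then $D_k(m,n)\equiv 0 \pmod p$. (ii) If $m\equiv m' \pmod{p-1}$ and $n\equiv n'\pmod{p-1}$, then $D_k(m,n)\equiv D_k(m',n')\pmod p$. (iii)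 If $p>k$, then $$D_k(p-1,n)\equiv\begin{cases}0 & (n\not\equiv 0 \pmod{p-1}),\\[2pt] \dfrac{(-1)^{k-1}}{(k-1)!} & (n\equiv 0\pmod{p-1})\end{cases}\pmod p,$$ where $1/(k-1)!$ denotes the inverse of $(k-1)!$ modulo $p$. (iv) $$D_k(p,n)\equiv\begin{cases}2^n-1 & (k=1),\\ 0 & (k\ge 2)\end{cases}\pmod p.$$ -/

import Mathlib

/-- A `(0,1)`-matrix with rows indexed by `α` and columns indexed by `β`. -/
abbrev ZeroOneMatrix (α β : Type) : Type := Matrix α β (Fin 2)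

namespace ZeroOneMatrix

/-- The row sum vector (sums taken in `ℕ`, not in `Fin 2`). -/
def rowSum {m n : ℕ} (A : ZeroOneMatrix (Fin m) (Fin n)) (i : Fin m) : ℕ :=
  ∑ j, (A i j : ℕ)

/-- The column sum vector (sums taken in `ℕ`, not in `Fin 2`). -/
def colSum {m n : ℕ} (A : ZeroOneMatrix (Fin m) (Fin n)) (j : Fin n) : ℕ :=
  ∑ i, (A i j : ℕ)

/-- `A` is lonesum: among `(0,1)`-matrices, it is uniquely determined by its row and column
sum vectors. -/
def IsLonesum {m n : ℕ} (A : ZeroOneMatrix (Fin m) (Fin n)) : Prop :=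
  ∀ B : ZeroOneMatrix (Fin m) (Fin n), B.rowSum = A.rowSum → B.colSum = A.colSum → B = A

/-- `A` is a Ferrers matrix: below a zero and to the right of a zero there are only zeros. -/
def IsFerrers {m n : ℕ} (A : ZeroOneMatrix (Fin m) (Fin n)) : Prop :=
  (∀ i i' j, i ≤ i' → A i j = 0 → A i' j = 0) ∧ (∀ i j j', j ≤ j' → A i j = 0 → A i j' = 0)

/-- No row and no column of `A` is zero. -/
def NoZeroLines {m n : ℕ} (A : ZeroOneMatrix (Fin m) (Fin n)) : Prop :=
  (∀ i, ∃ j, A i j ≠ 0) ∧ (∀ j, ∃ i, A i j ≠ 0)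

/-- `A ∼ B`: the matrix `A` is obtained from `B` by permuting rows and columns. The index types
may differ, so that `B` can be a block matrix. -/
def PermEquiv {α β γ δ : Type} (A : ZeroOneMatrix α β) (B : ZeroOneMatrix γ δ) : Prop :=
  ∃ (e : α ≃ γ) (f : β ≃ δ), A = B.submatrix e f

/-- `A` is lonesum decomposable: up to row and column permutations it is block diagonal with
lonesum diagonal blocks. -/
def IsLonesumDecomposable {m n : ℕ} (A : ZeroOneMatrix (Fin m) (Fin n)) : Prop :=
  ∃ (k : ℕ) (r c : Fin k → ℕ) (L : ∀ i, ZeroOneMatrix (Fin (r i)) (Fin (c i))),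
    (∀ i, (L i).IsLonesum) ∧ PermEquiv A (Matrix.blockDiagonal' L)

/-- `A` has a decomposition matrix with `k` Ferrers blocks: up to row and column permutations
it is `diag(F₁, …, F_k, O)`, where the `Fᵢ` are (non-empty) Ferrers matrices with no zero rows or
columns and `O` is a zero matrix, possibly without rows or without columns. -/
def HasDecompositionOrder {m n : ℕ} (A : ZeroOneMatrix (Fin m) (Fin n)) (k : ℕ) : Prop :=
  ∃ (r c : Fin k → ℕ) (a b : ℕ) (F : ∀ i, ZeroOneMatrix (Fin (r i)) (Fin (c i))),
    (∀ i, 0 < r i ∧ 0 < c i ∧ (F i).IsFerrers ∧ (F i).NoZeroLines) ∧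
      PermEquiv A (Matrix.fromBlocks (Matrix.blockDiagonal' F) 0 0
        (0 : ZeroOneMatrix (Fin a) (Fin b)))

end ZeroOneMatrix

/-- `D_k(m,n)`: the number of `m × n` lonesum decomposable matrices of decomposition order `k`. -/
noncomputable def lonesumD (k m n : ℕ) : ℕ :=
  Nat.card {A : ZeroOneMatrix (Fin m) (Fin n) //
    A.IsLonesumDecomposable ∧ A.HasDecompositionOrder k}

/-! Everything rests on one formula: k! · D_k(m,n) = ∑_t C(t-1,k-1) · c(m,t) · c(n,t), where c(m,t)
= t! · S(m+1,t+1) is `coverCount`. A Ferrers block without zero lines is a staircase with repeated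
rows and columns. So a matrix of order k is encoded by placing its nonzero rows and columns on k
chains, each position being used by a row and by a column (`IsLabelling`). The matrix determines the
labelling up to renaming the chains (`IsLabelling.exists_relabel`), hence the k!. Once the chain
lengths, a composition of t into k parts, are fixed, rows and columns are placed independently, in
c(m,t) and c(n,t) ways (`card_labelling`).

Modulo p, the factor t! in c(m,t) kills the terms with t ≥ p, and the alternating sum for c(m,t)
contains m only as an exponent, so Fermat gives periodicity in m and n. For m = p-1 only t = p-1
survives. For m = p, periodicity reduces to matrices with a single row. The case k ≥ p follows from
k! ∣ D_k, since every nonzero term is divisible by (k!)². -/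

open Finset

/-! ### Maps with prescribed range, and compositions -/

/-- The number of maps from an `m`-element set to the option type of a `t`-element set that hit
every element of the latter. -/
def coverCount (m t : ℕ) : ℕ := t.factorial * Nat.stirlingSecond (m + 1) (t + 1)

theorem factorial_dvd_coverCount (m t : ℕ) : t.factorial ∣ coverCount m t := Dvd.intro _ rfl

theorem coverCount_eq_zero_of_lt {m t : ℕ} (h : m < t) : coverCount m t = 0 := by
  rw [coverCount, Nat.stirlingSecond_eq_zero_of_lt (by omega), mul_zero]

theorem coverCount_zero_zero : coverCount 0 0 = 1 := by
  simp [coverCount, Nat.stirlingSecond_self]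

theorem coverCount_succ (m t : ℕ) :
    coverCount (m + 1) t = (t + 1) * coverCount m t + t * coverCount m (t - 1) := by
  cases t with
  | zero => simp [coverCount, Nat.stirlingSecond_succ_succ]
  | succ t =>
    simp only [coverCount, Nat.stirlingSecond_succ_succ (m + 1) (t + 1), Nat.factorial_succ,
      Nat.add_sub_cancel]
    ring

/-- Combinatorially, all maps into a set of `t + 1` elements are sorted by which of the `t`
non-`none` values they hit. The proof uses only the recurrence in `m`. -/
theorem sum_choose_mul_coverCount (m t : ℕ) :
    ∑ i ∈ range (t + 1), t.choose i * coverCount m i = (t + 1) ^ m := by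
  induction m generalizing t with
  | zero =>
    rw [sum_eq_single 0]
    · simp [coverCount_zero_zero]
    · intro i _ hi
      rw [coverCount_eq_zero_of_lt (by omega), mul_zero]
    · simp
  | succ m ih =>
    have shift : ∑ i ∈ range (t + 1), t.choose i * (i * coverCount m (i - 1)) =
        ∑ i ∈ range (t + 1), t.choose (i + 1) * ((i + 1) * coverCount m i) := by
      rw [sum_range_succ', sum_range_succ]
      simp
    simp only [coverCount_succ, mul_add, sum_add_distrib]
    rw [shift, ← sum_add_distrib, pow_succ, ← ih t, sum_mul]
    refine sum_congr rfl fun i _ => ?_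
    have := Nat.add_one_mul_choose_eq t i
    rw [Nat.choose_succ_succ] at this
    zify at this ⊢
    linear_combination (-coverCount m i : ℤ) * this

/-- Inversion over the subset lattice: the sums over power sets determine the summand, and
`coverCount` has the same sums. -/
theorem eq_coverCount_of_sum_powerset {α : Type*} (m : ℕ) (N : Finset α → ℕ)
    (hN : ∀ J, ∑ K ∈ J.powerset, N K = (#J + 1) ^ m) (J : Finset α) :
    N J = coverCount m #J := by
  classical
  induction J using Finset.strongInduction with
  | H J ih =>
    have h1 := hN J
    have h2 := sum_powerset_apply_card (coverCount m) (x := J)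
    simp only [smul_eq_mul, sum_choose_mul_coverCount] at h2
    rw [← h2, ← insert_erase (mem_powerset_self J), sum_insert (notMem_erase _ _),
      sum_insert (notMem_erase _ _)] at h1
    rw [sum_congr rfl (g := fun K => coverCount m #K)] at h1
    · omega
    · intro K hK
      rw [mem_erase, mem_powerset] at hK
      exact ih K (hK.2.ssubset_of_ne hK.1)

/-- By Newton's expansion, `coverCount m t` is the `t`-th forward difference at 0 of `x ↦ (x + 1) ^
m`. In this form `m` occurs only as an exponent, ready for Fermat's little theorem. -/
theorem coverCount_eq_sum (m t : ℕ) :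
    (coverCount m t : ℤ) =
      ∑ i ∈ range (t + 1), (-1) ^ (t - i) * (t.choose i : ℤ) * ((i : ℤ) + 1) ^ m := by
  set f : ℕ → ℤ := fun x => ((x : ℤ) + 1) ^ m with hf
  suffices h : (coverCount m t : ℤ) = (fwdDiff 1)^[t] f 0 by
    rw [h, fwdDiff_iter_eq_sum_shift]
    simp [hf]
  induction t using Nat.strong_induction_on with
  | _ t ih =>
    have h1 := shift_eq_sum_fwdDiff_iter 1 f t 0
    have h2 : (∑ i ∈ range (t + 1), (t.choose i : ℤ) * coverCount m i) = ((t : ℤ) + 1) ^ m := by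
      exact_mod_cast sum_choose_mul_coverCount m t
    rw [sum_range_succ] at h1 h2
    rw [sum_congr rfl fun i hi => by rw [ih i (mem_range.1 hi)]] at h2
    simp [hf] at h1 h2
    linarith

/-- `φ` takes the values in `J` and possibly `none`. -/
def HasRange {ι α : Type*} (φ : ι → Option α) (J : Set α) : Prop :=
  ∀ x, (∃ i, φ i = some x) ↔ x ∈ J

theorem card_hasRange {ι α : Type*} [Fintype ι] (J : Finset α) :
    Nat.card {φ : ι → Option α // HasRange φ (J : Set α)} = coverCount (Fintype.card ι) #J := by
  classical
  refine eq_coverCount_of_sum_powerset (Fintype.card ι)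
    (fun J => Nat.card {φ : ι → Option α // HasRange φ (J : Set α)}) (fun J => ?_) J
  set S : Finset (ι → Option α) := Fintype.piFinset fun _ => insertNone J with hS
  have hcard : #S = (#J + 1) ^ Fintype.card ι := by
    simp [hS, card_insertNone]
  set r : (ι → Option α) → Finset α := fun φ => eraseNone (univ.image φ) with hr
  have hmr : ∀ φ x, x ∈ r φ ↔ ∃ i, φ i = some x := by
    intro φ x
    simp [hr]
  have hmap : ∀ φ ∈ S, r φ ∈ J.powerset := by
    intro φ hφ
    rw [mem_powerset]
    intro x hx
    obtain ⟨i, hi⟩ := (hmr φ x).1 hx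
    have := Fintype.mem_piFinset.1 hφ i
    rw [hi] at this
    simpa using this
  rw [← hcard, card_eq_sum_card_fiberwise (f := r) (t := J.powerset) hmap]
  refine sum_congr rfl fun K hK => ?_
  rw [← Nat.card_eq_finsetCard]
  refine Nat.card_congr (Equiv.subtypeEquivRight fun φ => ?_)
  rw [mem_filter]
  constructor
  · intro h
    refine ⟨Fintype.mem_piFinset.2 fun i => ?_, ?_⟩
    · rw [mem_insertNone]
      intro x hx
      exact mem_powerset.1 hK ((h x).1 ⟨i, hx⟩)
    · ext x
      rw [hmr]
      exact h x
  · rintro ⟨-, rfl⟩ x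
    rw [mem_coe, hmr]

theorem finite_hasRange {ι α : Type*} [Finite ι] (J : Finset α) :
    Finite {φ : ι → Option α // HasRange φ (J : Set α)} := by
  refine Set.Finite.to_subtype ((Set.Finite.pi' fun _ => (insertNone J).finite_toSet).subset ?_)
  intro φ hφ i
  rw [mem_coe, mem_insertNone]
  exact fun x hx => (hφ x).1 ⟨i, hx⟩

/-- The number of compositions of `t + k` into `k` parts. -/
theorem card_pos_sum_eq (k t : ℕ) :
    Nat.card {d : Fin k → ℕ // (∀ a, 0 < d a) ∧ ∑ a, d a = t + k} =
      (k + t - 1).choose t := by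
  classical
  have key := Finset.card_finsuppAntidiag_nat_eq_choose (s := (univ : Finset (Fin k))) t
  rw [card_univ, Fintype.card_fin] at key
  rw [← key, ← Nat.card_eq_finsetCard]
  refine Nat.card_congr
    { toFun := fun d => ⟨Finsupp.equivFunOnFinite.symm fun a => d.1 a - 1, ?_⟩
      invFun := fun g => ⟨fun a => g.1 a + 1, fun a => Nat.succ_pos _, ?_⟩
      left_inv := fun d => ?_
      right_inv := fun g => ?_ }
  · rw [mem_finsuppAntidiag]
    refine ⟨?_, subset_univ _⟩
    have h : ∑ a, d.1 a = ∑ a, (d.1 a - 1) + k := by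
      rw [sum_congr rfl fun a _ => (Nat.sub_add_cancel (d.2.1 a)).symm, sum_add_distrib]
      simp
    have := d.2.2
    simp only [Finsupp.equivFunOnFinite_symm_apply_apply]
    omega
  · have := (mem_finsuppAntidiag.1 g.2).1
    rw [sum_add_distrib, this]
    simp
  · ext a
    exact Nat.sub_add_cancel (d.2.1 a)
  · ext a
    simp

/-! ### Range counts and binomial coefficients modulo p -/

section ModPrime

variable {p : ℕ} [Fact p.Prime]

theorem ZMod.pow_eq_pow_of_modEq (x : ZMod p) {m m' : ℕ} (hm : 0 < m) (hm' : 0 < m')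
    (h : m ≡ m' [MOD (p - 1)]) : x ^ m = x ^ m' := by
  by_cases hx : x = 0
  · rw [hx, zero_pow hm.ne', zero_pow hm'.ne']
  · have h1 := ZMod.pow_card_sub_one_eq_one hx
    rw [pow_eq_pow_mod m h1, pow_eq_pow_mod m' h1, h]

theorem cast_coverCount_eq_sum (m t : ℕ) :
    (coverCount m t : ZMod p) =
      ∑ i ∈ range (t + 1), (-1) ^ (t - i) * (t.choose i : ZMod p) * ((i : ZMod p) + 1) ^ m := by
  have := congrArg (Int.cast : ℤ → ZMod p) (coverCount_eq_sum m t)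
  push_cast at this
  exact this

theorem cast_coverCount_eq_zero (m : ℕ) {t : ℕ} (h : p ≤ t) : (coverCount m t : ZMod p) = 0 :=
  (ZMod.natCast_eq_zero_iff _ _).2
    ((((Fact.out : p.Prime).dvd_factorial).2 h).trans (factorial_dvd_coverCount m t))

theorem cast_coverCount_congr {m m' : ℕ} (hm : 0 < m) (hm' : 0 < m')
    (h : m ≡ m' [MOD (p - 1)]) (t : ℕ) : (coverCount m t : ZMod p) = coverCount m' t := by
  simp only [cast_coverCount_eq_sum, ZMod.pow_eq_pow_of_modEq _ hm hm' h]

/-- By Fermat all the powers are 1, as the bases 1, …, t + 1 are below p; what remains is the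
expansion of (1 - 1)^t. -/
theorem cast_coverCount_pred {t : ℕ} (h0 : 0 < t) (h : t < p - 1) :
    (coverCount (p - 1) t : ZMod p) = 0 := by
  rw [cast_coverCount_eq_sum]
  have h1 : ∀ i ∈ range (t + 1), (-1) ^ (t - i) * (t.choose i : ZMod p) *
      ((i : ZMod p) + 1) ^ (p - 1) = (1 : ZMod p) ^ i * (-1) ^ (t - i) * (t.choose i) := by
    intro i hi
    rw [mem_range] at hi
    rw [ZMod.pow_card_sub_one_eq_one, one_pow, mul_one, one_mul]
    intro h2
    have h3 : ((i + 1 : ℕ) : ZMod p) = 0 := by exact_mod_cast h2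
    rw [ZMod.natCast_eq_zero_iff] at h3
    have := Nat.le_of_dvd (by omega) h3
    omega
  rw [sum_congr rfl h1, ← add_pow, add_neg_cancel, zero_pow h0.ne']

theorem cast_choose_pred {i : ℕ} (h : i ≤ p - 1) : ((p - 1).choose i : ZMod p) = (-1) ^ i := by
  have hp := (Fact.out : p.Prime).two_le
  induction i with
  | zero => simp
  | succ i ih =>
    have h1 : ((p - 1 + 1).choose (i + 1) : ZMod p) = 0 := by
      rw [Nat.sub_add_cancel (by omega), ZMod.natCast_eq_zero_iff]
      exact (Fact.out : p.Prime).dvd_choose_self (by omega) (by omega)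
    rw [Nat.choose_succ_succ, Nat.cast_add, ih (by omega)] at h1
    rw [pow_succ]
    linear_combination h1

theorem cast_choose_pred_pred {i : ℕ} (h : i ≤ p - 2) :
    ((p - 2).choose i : ZMod p) = (-1) ^ i * (i + 1) := by
  have hp := (Fact.out : p.Prime).two_le
  induction i with
  | zero => simp
  | succ i ih =>
    have h1 := cast_choose_pred (p := p) (i := i + 1) (by omega)
    rw [show p - 1 = p - 2 + 1 by omega, Nat.choose_succ_succ, Nat.cast_add, ih (by omega)] at h1
    rw [pow_succ] at h1 ⊢
    push_cast
    linear_combination h1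

theorem ZMod.sum_pow_eq (n : ℕ) (hn : 0 < n) :
    ∑ x : ZMod p, x ^ n = if p - 1 ∣ n then -1 else 0 := by
  have h := FiniteField.sum_pow_units (ZMod p) n
  rw [ZMod.card] at h
  rw [← h, ← sum_erase_add univ _ (mem_univ (0 : ZMod p)), zero_pow hn.ne', add_zero]
  symm
  refine sum_bij (fun u _ => (u : ZMod p)) ?_ ?_ ?_ ?_
  · intro u _
    simp
  · intro u _ v _ huv
    exact Units.ext huv
  · intro x hx
    exact ⟨Units.mk0 x (by simpa using hx), mem_univ _, rfl⟩
  · intro u _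
    rfl

/-- The signed coefficients (-1)^(p-1-i) C(p-1,i) are all 1 modulo p, so the alternating sum becomes
the power sum over the whole field. -/
theorem cast_coverCount_pred_right {n : ℕ} (hn : 0 < n) :
    (coverCount n (p - 1) : ZMod p) = if p - 1 ∣ n then -1 else 0 := by
  have hp := (Fact.out : p.Prime).two_le
  have hneg : ((-1 : ZMod p)) ^ (p - 1) = 1 :=
    ZMod.pow_card_sub_one_eq_one (neg_ne_zero.2 one_ne_zero)
  rw [cast_coverCount_eq_sum, ← ZMod.sum_pow_eq n hn, ← Equiv.sum_comp (Equiv.addRight (1 : ZMod p)),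
    Nat.sub_add_cancel (by omega)]
  refine sum_bij (fun i _ => (i : ZMod p)) (fun _ _ => mem_univ _) ?_ ?_ ?_
  · intro i hi j hj hij
    rw [mem_range] at hi hj
    rw [ZMod.natCast_eq_natCast_iff] at hij
    exact Nat.ModEq.eq_of_lt_of_lt hij hi hj
  · intro x _
    exact ⟨x.val, mem_range.2 (ZMod.val_lt x), by simp⟩
  · intro i hi
    rw [mem_range] at hi
    rw [cast_choose_pred (by omega), ← pow_add, Nat.sub_add_cancel (by omega), hneg, one_mul]
    rfl

end ModPrime

/-! ### Labellings, and their uniqueness up to renaming chains -/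

namespace ZeroOneMatrix

/-- The positions below a profile `d`: `k` disjoint chains of lengths `d a`. -/
def chains {k : ℕ} (d : Fin k → ℕ) : Finset (Fin k × ℕ) :=
  (univ.sigma fun a => range (d a)).map (Equiv.sigmaEquivProd (Fin k) ℕ).toEmbedding

theorem mem_chains {k : ℕ} {d : Fin k → ℕ} {x : Fin k × ℕ} : x ∈ chains d ↔ x.2 < d x.1 := by
  obtain ⟨a, s⟩ := x
  simp [chains, Finset.mem_map_equiv]

theorem card_chains {k : ℕ} (d : Fin k → ℕ) : #(chains d) = ∑ a, d a := by
  simp [chains]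

theorem chains_injective {k : ℕ} : Function.Injective (chains (k := k)) := by
  intro d d' h
  ext a
  have h1 : ∀ s, s < d a ↔ s < d' a := fun s => by
    rw [← mem_chains (x := (a, s)), h, mem_chains]
  have := h1 (d a)
  have := h1 (d' a)
  omega

/-- `φ` and `ψ` place the rows and the columns on `k` non-empty chains, every position being taken
by a row and by a column; the value `none` is meant for zero rows and columns. -/
def IsLabelling {k m n : ℕ} (φ : Fin m → Option (Fin k × ℕ)) (ψ : Fin n → Option (Fin k × ℕ)) :
    Prop :=
  ∃ d : Fin k → ℕ, (∀ a, 0 < d a) ∧ HasRange φ (chains d : Set (Fin k × ℕ)) ∧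
    HasRange ψ (chains d : Set (Fin k × ℕ))

/-- The type of all labellings. -/
abbrev Labelling (k m n : ℕ) : Type :=
  {x : (Fin m → Option (Fin k × ℕ)) × (Fin n → Option (Fin k × ℕ)) // IsLabelling x.1 x.2}

open Classical in
/-- The matrix with a one where the row and the column are on the same chain, the row not being
above the column. -/
noncomputable def ofLabels {k m n : ℕ} (φ : Fin m → Option (Fin k × ℕ))
    (ψ : Fin n → Option (Fin k × ℕ)) : ZeroOneMatrix (Fin m) (Fin n) :=
  fun i j => if ∃ a s t, φ i = some (a, s) ∧ ψ j = some (a, t) ∧ s ≤ t then 1 else 0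

theorem ofLabels_ne_zero {k m n : ℕ} {φ : Fin m → Option (Fin k × ℕ)}
    {ψ : Fin n → Option (Fin k × ℕ)} {i : Fin m} {j : Fin n} :
    ofLabels φ ψ i j ≠ 0 ↔ ∃ a s t, φ i = some (a, s) ∧ ψ j = some (a, t) ∧ s ≤ t := by
  unfold ofLabels
  split_ifs with h
  · exact iff_of_true one_ne_zero h
  · exact iff_of_false (not_not_intro rfl) h

theorem ext_of_ne_zero {α β : Type} {A B : ZeroOneMatrix α β}
    (h : ∀ i j, A i j ≠ 0 ↔ B i j ≠ 0) : A = B := by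
  ext i j
  have := h i j
  have := (A i j).isLt
  have := (B i j).isLt
  simp only [Fin.ext_iff, ne_eq, Fin.val_zero] at *
  omega

section Unique

variable {k m n : ℕ} {φ φ' : Fin m → Option (Fin k × ℕ)} {ψ ψ' : Fin n → Option (Fin k × ℕ)}

theorem IsLabelling.exists_col (h : IsLabelling φ ψ) {i : Fin m} {x : Fin k × ℕ}
    (hi : φ i = some x) : ∃ j, ψ j = some x := by
  obtain ⟨d, -, h1, h2⟩ := h
  exact (h2 x).2 ((h1 x).1 ⟨i, hi⟩)

theorem IsLabelling.exists_row (h : IsLabelling φ ψ) {j : Fin n} {x : Fin k × ℕ}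
    (hj : ψ j = some x) : ∃ i, φ i = some x := by
  obtain ⟨d, -, h1, h2⟩ := h
  exact (h1 x).2 ((h2 x).1 ⟨j, hj⟩)

theorem IsLabelling.exists_row_of_le (h : IsLabelling φ ψ) {i : Fin m} {a : Fin k} {s t : ℕ}
    (hi : φ i = some (a, t)) (hst : s ≤ t) : ∃ i', φ i' = some (a, s) := by
  obtain ⟨d, -, h1, h2⟩ := h
  refine (h1 _).2 ?_
  have := (h1 _).1 ⟨i, hi⟩
  rw [mem_coe, mem_chains] at this ⊢
  exact lt_of_le_of_lt hst this

theorem IsLabelling.exists_row_of_block (h : IsLabelling φ ψ) (a : Fin k) :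
    ∃ i, φ i = some (a, 0) := by
  obtain ⟨d, h0, h1, h2⟩ := h
  refine (h1 _).2 ?_
  rw [mem_coe, mem_chains]
  exact h0 a

/-- A row is a zero row if and only if it has no label. -/
theorem IsLabelling.exists_ne_zero_iff (h : IsLabelling φ ψ) (i : Fin m) :
    (∃ j, ofLabels φ ψ i j ≠ 0) ↔ ∃ x, φ i = some x := by
  constructor
  · rintro ⟨j, hj⟩
    obtain ⟨a, s, t, h1, -⟩ := ofLabels_ne_zero.1 hj
    exact ⟨_, h1⟩
  · rintro ⟨⟨a, s⟩, hx⟩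
    obtain ⟨j, hj⟩ := h.exists_col hx
    exact ⟨j, ofLabels_ne_zero.2 ⟨a, s, s, hx, hj, le_rfl⟩⟩

/-- Two rows are on the same chain if and only if their supports meet. -/
theorem IsLabelling.exists_common_iff (h : IsLabelling φ ψ) {i i' : Fin m} {x x' : Fin k × ℕ}
    (hi : φ i = some x) (hi' : φ i' = some x') :
    (∃ j, ofLabels φ ψ i j ≠ 0 ∧ ofLabels φ ψ i' j ≠ 0) ↔ x.1 = x'.1 := by
  obtain ⟨a, s⟩ := x
  obtain ⟨a', s'⟩ := x'
  constructor
  · rintro ⟨j, hj, hj'⟩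
    obtain ⟨b, u, v, h1, h2, -⟩ := ofLabels_ne_zero.1 hj
    obtain ⟨b', u', v', h1', h2', -⟩ := ofLabels_ne_zero.1 hj'
    simp_all
  · rintro (rfl : a = a')
    rcases le_total s s' with hs | hs
    · obtain ⟨j, hj⟩ := h.exists_col hi'
      exact ⟨j, ofLabels_ne_zero.2 ⟨_, _, _, hi, hj, hs⟩, ofLabels_ne_zero.2 ⟨_, _, _, hi', hj, le_rfl⟩⟩
    · obtain ⟨j, hj⟩ := h.exists_col hi
      exact ⟨j, ofLabels_ne_zero.2 ⟨_, _, _, hi, hj, le_rfl⟩, ofLabels_ne_zero.2 ⟨_, _, _, hi', hj, hs⟩⟩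

/-- Supports of rows on a chain are ordered oppositely to the labels. -/
theorem IsLabelling.support_subset_iff (h : IsLabelling φ ψ) {i i' : Fin m} {a : Fin k}
    {s s' : ℕ} (hi : φ i = some (a, s)) (hi' : φ i' = some (a, s')) :
    (∀ j, ofLabels φ ψ i' j ≠ 0 → ofLabels φ ψ i j ≠ 0) ↔ s ≤ s' := by
  constructor
  · intro hsub
    obtain ⟨j, hj⟩ := h.exists_col hi'
    obtain ⟨b, u, v, h1, h2, h3⟩ := ofLabels_ne_zero.1
      (hsub j (ofLabels_ne_zero.2 ⟨_, _, _, hi', hj, le_rfl⟩))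
    simp_all
  · intro hs j hj
    obtain ⟨b, u, v, h1, h2, h3⟩ := ofLabels_ne_zero.1 hj
    rw [hi', Option.some.injEq, Prod.mk.injEq] at h1
    obtain ⟨rfl, rfl⟩ := h1
    exact ofLabels_ne_zero.2 ⟨_, _, _, hi, h2, hs.trans h3⟩

/-- Labellings of a matrix that put the rows on the same chains agree on the rows. -/
theorem IsLabelling.row_label_eq (h : IsLabelling φ ψ) (h' : IsLabelling φ' ψ')
    (hA : ofLabels φ ψ = ofLabels φ' ψ')
    (hb : ∀ i, (φ i).map Prod.fst = (φ' i).map Prod.fst) (a : Fin k) (t : ℕ) (i : Fin m)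
    (hi : φ i = some (a, t)) : φ' i = some (a, t) := by
  have hb1 : ∀ i t, φ i = some (a, t) → ∃ t', φ' i = some (a, t') := by
    intro i t hi
    have h1 := hb i
    rw [hi] at h1
    rw [Option.map_some, eq_comm, Option.map_eq_some_iff] at h1
    obtain ⟨⟨b, t'⟩, h2, rfl⟩ := h1
    exact ⟨t', h2⟩
  have hb2 : ∀ i t, φ' i = some (a, t) → ∃ t', φ i = some (a, t') := by
    intro i t hi
    have h1 := hb i
    rw [hi] at h1
    simp only [Option.map_some, Option.map_eq_some_iff] at h1
    obtain ⟨⟨b, t'⟩, h2, rfl⟩ := h1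
    exact ⟨t', h2⟩
  have hiff : ∀ i i' s s' u u', φ i = some (a, s) → φ i' = some (a, s') →
      φ' i = some (a, u) → φ' i' = some (a, u') → (s ≤ s' ↔ u ≤ u') := by
    intro i i' s s' u u' h1 h2 h3 h4
    rw [← h.support_subset_iff h1 h2, ← h'.support_subset_iff h3 h4, hA]
  induction t using Nat.strong_induction_on generalizing i with
  | _ t ih =>
    obtain ⟨t', ht'⟩ := hb1 i t hi
    -- If t < t', a row that `φ'` puts at t has a `φ`-label u < t, and induction forces u = t. If t'
    -- < t, a row that `φ` puts at t' has the same `φ'`-label as i, so the order comparison gives t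
    -- ≤ t'.
    rcases lt_trichotomy t t' with hlt | rfl | hlt
    · obtain ⟨i', hi'⟩ := h'.exists_row_of_le ht' hlt.le
      obtain ⟨u, hu⟩ := hb2 i' t hi'
      have h1 := hiff i i' t u t' t hi hu ht' hi'
      have h2 := ih u (by omega) i' hu
      rw [hi'] at h2
      simp only [Option.some.injEq, Prod.mk.injEq, true_and] at h2
      omega
    · exact ht'
    · obtain ⟨i', hi'⟩ := h.exists_row_of_le hi hlt.le
      have h2 := ih t' hlt i' hi'
      have h1 := hiff i i' t t' t' t' hi hi' ht' h2
      omega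

/-- The label of a nonzero column is the greatest label of a row with a one in it, so the row labels
and the matrix determine it. -/
theorem IsLabelling.col_label_eq (h : IsLabelling φ ψ)
    (hA : ofLabels φ ψ = ofLabels φ ψ') (h' : IsLabelling φ ψ') (x : Fin k × ℕ) (j : Fin n)
    (hj : ψ j = some x) : ψ' j = some x := by
  obtain ⟨a, t⟩ := x
  obtain ⟨i, hi⟩ := h.exists_row hj
  have h1 : ofLabels φ ψ i j ≠ 0 := ofLabels_ne_zero.2 ⟨_, _, _, hi, hj, le_rfl⟩
  rw [hA] at h1
  obtain ⟨b, s, t', h2, h3, h4⟩ := ofLabels_ne_zero.1 h1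
  rw [hi, Option.some.injEq, Prod.mk.injEq] at h2
  obtain ⟨rfl, rfl⟩ := h2
  obtain ⟨i', hi'⟩ := h'.exists_row h3
  have h5 : ofLabels φ ψ' i' j ≠ 0 := ofLabels_ne_zero.2 ⟨_, _, _, hi', h3, le_rfl⟩
  rw [← hA] at h5
  obtain ⟨b, s, u, h6, h7, h8⟩ := ofLabels_ne_zero.1 h5
  rw [hj, Option.some.injEq, Prod.mk.injEq] at h7
  rw [hi', Option.some.injEq, Prod.mk.injEq] at h6
  rw [h3, show t' = t by omega]

theorem option_funext {ι α : Type*} {f g : ι → Option α} (h : ∀ x i, f i = some x → g i = some x)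
    (h' : ∀ x i, g i = some x → f i = some x) : f = g := by
  ext i x
  exact ⟨h x i, h' x i⟩

theorem IsLabelling.eq_of_blocks_eq (h : IsLabelling φ ψ) (h' : IsLabelling φ' ψ')
    (hA : ofLabels φ ψ = ofLabels φ' ψ')
    (hb : ∀ i, (φ i).map Prod.fst = (φ' i).map Prod.fst) : φ = φ' ∧ ψ = ψ' := by
  have h1 : φ = φ' := option_funext (fun x i => h.row_label_eq h' hA hb x.1 x.2 i)
    (fun x i => h'.row_label_eq h hA.symm (fun i => (hb i).symm) x.1 x.2 i)
  subst h1
  exact ⟨rfl, option_funext (fun x i => h.col_label_eq hA h' x i)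
    (fun x i => h'.col_label_eq hA.symm h x i)⟩

/-- Renaming the chains of a labelling. -/
def relabel (σ : Equiv.Perm (Fin k)) {ι : Type} (φ : ι → Option (Fin k × ℕ)) :
    ι → Option (Fin k × ℕ) :=
  fun i => (φ i).map (Prod.map σ id)

theorem relabel_eq_some {σ : Equiv.Perm (Fin k)} {ι : Type} {φ : ι → Option (Fin k × ℕ)} {i : ι}
    {a : Fin k} {s : ℕ} : relabel σ φ i = some (a, s) ↔ φ i = some (σ.symm a, s) := by
  simp only [relabel, Option.map_eq_some_iff, Prod.exists, Prod.map_apply, id, Prod.mk.injEq]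
  constructor
  · rintro ⟨b, t, h, rfl, rfl⟩
    simpa using h
  · intro h
    exact ⟨_, _, h, by simp, rfl⟩

theorem HasRange.relabel {ι : Type} {φ : ι → Option (Fin k × ℕ)} {d : Fin k → ℕ}
    (h : HasRange φ (chains d : Set (Fin k × ℕ))) (σ : Equiv.Perm (Fin k)) :
    HasRange (relabel σ φ) (chains (d ∘ σ.symm) : Set (Fin k × ℕ)) := by
  rintro ⟨a, s⟩
  simp only [relabel_eq_some, h _, mem_coe, mem_chains, Function.comp]

theorem IsLabelling.relabel (h : IsLabelling φ ψ) (σ : Equiv.Perm (Fin k)) :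
    IsLabelling (relabel σ φ) (relabel σ ψ) := by
  obtain ⟨d, h0, h1, h2⟩ := h
  exact ⟨d ∘ σ.symm, fun a => h0 _, HasRange.relabel h1 σ, HasRange.relabel h2 σ⟩

theorem ofLabels_relabel (σ : Equiv.Perm (Fin k)) (φ : Fin m → Option (Fin k × ℕ))
    (ψ : Fin n → Option (Fin k × ℕ)) :
    ofLabels (ZeroOneMatrix.relabel σ φ) (ZeroOneMatrix.relabel σ ψ) = ofLabels φ ψ := by
  refine ext_of_ne_zero fun i j => ?_
  simp only [ofLabels_ne_zero, relabel_eq_some]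
  exact σ.symm.exists_congr fun _ => Iff.rfl

theorem IsLabelling.relabel_injective (h : IsLabelling φ ψ) {σ τ : Equiv.Perm (Fin k)}
    (hst : ZeroOneMatrix.relabel σ φ = ZeroOneMatrix.relabel τ φ) : σ = τ := by
  ext1 a
  obtain ⟨i, hi⟩ := h.exists_row_of_block a
  have := congrFun hst i
  simp only [ZeroOneMatrix.relabel, hi, Option.map_some, Option.some.injEq, Prod.map_apply,
    Prod.mk.injEq] at this
  exact this.1

/-- Two labellings of the same matrix differ by a renaming of the chains. -/
theorem IsLabelling.exists_relabel (h : IsLabelling φ ψ) (h' : IsLabelling φ' ψ')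
    (hA : ofLabels φ ψ = ofLabels φ' ψ') :
    ∃ σ : Equiv.Perm (Fin k), ZeroOneMatrix.relabel σ φ = φ' ∧ ZeroOneMatrix.relabel σ ψ = ψ' := by
  have hsome : ∀ i, (∃ x, φ i = some x) ↔ ∃ x, φ' i = some x := fun i => by
    rw [← h.exists_ne_zero_iff, ← h'.exists_ne_zero_iff, hA]
  have hcls : ∀ i i' x x' y y', φ i = some x → φ i' = some x' → φ' i = some y → φ' i' = some y' →
      (x.1 = x'.1 ↔ y.1 = y'.1) := by
    intro i i' x x' y y' h1 h2 h3 h4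
    rw [← h.exists_common_iff h1 h2, ← h'.exists_common_iff h3 h4, hA]
  choose r hr using h.exists_row_of_block
  -- The row `r a` at the start of chain a represents it; σ sends a to the chain on which `φ'` puts
  -- that row. Whether two rows share a chain can be read off the matrix, so σ is well defined on
  -- all rows and injective.
  have hex : ∀ a, ∃ y, φ' (r a) = some y := fun a => (hsome _).1 ⟨_, hr a⟩
  choose y hy using hex
  have hinj : Function.Injective fun a => (y a).1 := by
    intro a b hab
    exact (hcls _ _ _ _ _ _ (hr a) (hr b) (hy a) (hy b)).2 hab
  let σ : Equiv.Perm (Fin k) := Equiv.ofBijective _ (Finite.injective_iff_bijective.1 hinj)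
  refine ⟨σ, (h.relabel σ).eq_of_blocks_eq h' ((ofLabels_relabel σ φ ψ).trans hA) fun i => ?_⟩
  rcases hφ : φ i with _ | x
  · rcases hφ' : φ' i with _ | x'
    · simp [ZeroOneMatrix.relabel, hφ]
    · obtain ⟨x, hx⟩ := (hsome i).2 ⟨_, hφ'⟩
      simp [hφ] at hx
  · obtain ⟨x', hx'⟩ := (hsome i).1 ⟨_, hφ⟩
    have := (hcls i (r x.1) x _ x' _ hφ (hr _) hx' (hy _)).1 rfl
    simp [ZeroOneMatrix.relabel, hφ, hx', σ, this]

end Unique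

/-! ### Counting labellings -/

/-- The number of labellings is `k!` times the number of matrices that have one. -/
theorem card_labelling_eq_factorial_mul (k m n : ℕ) :
    Nat.card (Labelling k m n) = k.factorial * Nat.card
      {A : ZeroOneMatrix (Fin m) (Fin n) // ∃ x : Labelling k m n, ofLabels x.1.1 x.1.2 = A} := by
  have : k.factorial = Nat.card (Equiv.Perm (Fin k)) := by
    rw [Nat.card_eq_fintype_card, Fintype.card_perm, Fintype.card_fin]
  rw [this, ← Nat.card_prod]
  let F : Equiv.Perm (Fin k) × {A : ZeroOneMatrix (Fin m) (Fin n) //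
      -- The permutations of the chains act freely on the labellings, with the fibres of `ofLabels`
      -- as orbits; `F` moves a chosen point of each orbit.
      ∃ x : Labelling k m n, ofLabels x.1.1 x.1.2 = A} → Labelling k m n := fun y =>
    ⟨(relabel y.1 y.2.2.choose.1.1, relabel y.1 y.2.2.choose.1.2), y.2.2.choose.2.relabel y.1⟩
  have hF : ∀ y, ofLabels (F y).1.1 (F y).1.2 = y.2.1 := fun y =>
    (ofLabels_relabel _ _ _).trans y.2.2.choose_spec
  refine (Nat.card_congr (Equiv.ofBijective F ⟨?_, ?_⟩)).symm
  · rintro ⟨σ, A⟩ ⟨τ, B⟩ hst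
    have hAB : A = B := Subtype.ext (by rw [← hF (σ, A), ← hF (τ, B), hst])
    subst hAB
    have := A.2.choose.2.relabel_injective (congrArg (fun z : Labelling k m n => z.1.1) hst)
    exact Prod.ext this rfl
  · rintro ⟨⟨φ, ψ⟩, h⟩
    let A : {A : ZeroOneMatrix (Fin m) (Fin n) //
      ∃ x : Labelling k m n, ofLabels x.1.1 x.1.2 = A} := ⟨_, ⟨⟨(φ, ψ), h⟩, rfl⟩⟩
    obtain ⟨σ, h1, h2⟩ := A.2.choose.2.exists_relabel h A.2.choose_spec
    exact ⟨(σ, A), Subtype.ext (Prod.ext h1 h2)⟩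

/-- The number of compositions of `t` into `k` parts. -/
noncomputable def numCompositions (k t : ℕ) : ℕ :=
  Nat.card {d : Fin k → ℕ // (∀ a, 0 < d a) ∧ ∑ a, d a = t}

/-- Labellings are sorted by their profile `d`, which they determine; the number with a given
profile depends only on its total t. Each position needs a row of its own, so t ≤ m. The bound `N`
is left free so that the sum can later be cut at p. -/
theorem card_labelling (k m n N : ℕ) (hN : m < N) :
    Nat.card (Labelling k m n) =
      ∑ t ∈ range N, numCompositions k t * (coverCount m t * coverCount n t) := by
  classical
  have hfin : ∀ t, Finite {d : Fin k → ℕ // (∀ a, 0 < d a) ∧ ∑ a, d a = t} := by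
    intro t
    refine Set.Finite.to_subtype ((Set.finite_Iic (fun _ : Fin k => t)).subset ?_)
    rintro d ⟨-, rfl⟩ a
    exact single_le_sum (f := d) (fun _ _ => Nat.zero_le _) (mem_univ a)
  have hfin' := fun d : Fin k → ℕ => finite_hasRange (ι := Fin m) (chains d)
  have hfin'' := fun d : Fin k → ℕ => finite_hasRange (ι := Fin n) (chains d)
  let T := Σ t : Fin N, Σ d : {d : Fin k → ℕ // (∀ a, 0 < d a) ∧ ∑ a, d a = t},
    {φ : Fin m → Option (Fin k × ℕ) // HasRange φ (chains d.1 : Set (Fin k × ℕ))} ×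
    {ψ : Fin n → Option (Fin k × ℕ) // HasRange ψ (chains d.1 : Set (Fin k × ℕ))}
  let F : T → Labelling k m n := fun x =>
    ⟨(x.2.2.1.1, x.2.2.2.1), x.2.1.1, x.2.1.2.1, x.2.2.1.2, x.2.2.2.2⟩
  have hF : Function.Bijective F := by
    constructor
    · rintro ⟨⟨t, ht⟩, ⟨d, hd, hdt⟩, ⟨φ, hφ⟩, ⟨ψ, hψ⟩⟩
        ⟨⟨t', ht'⟩, ⟨d', hd', hdt'⟩, ⟨φ', hφ'⟩, ⟨ψ', hψ'⟩⟩ h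
      simp only [F] at h
      obtain ⟨rfl, rfl⟩ := h
      have : d = d' := chains_injective (by
        ext x
        rw [← mem_coe, ← hφ x, hφ' x, mem_coe])
      subst this
      obtain rfl : t = t' := hdt.symm.trans hdt'
      rfl
    · rintro ⟨⟨φ, ψ⟩, d, h0, h1, h2⟩
      have hle : ∑ a, d a < N := by
        refine lt_of_le_of_lt ?_ hN
        rw [← card_chains]
        have : ∀ x : chains d, ∃ i, φ i = some x.1 := fun x => (h1 x.1).2 x.2
        choose g hg using this
        have hg : Function.Injective g := by
          intro x y hxy
          have := hg x
          rw [hxy, hg y, Option.some.injEq] at this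
          exact Subtype.ext this.symm
        simpa using Fintype.card_le_of_injective g hg
      exact ⟨⟨⟨_, hle⟩, ⟨d, h0, rfl⟩, ⟨φ, h1⟩, ⟨ψ, h2⟩⟩, rfl⟩
  rw [← Nat.card_congr (Equiv.ofBijective F hF), ← Fin.sum_univ_eq_sum_range
    (fun t => numCompositions k t * (coverCount m t * coverCount n t))]
  have inner : ∀ t : ℕ, Nat.card (Σ d : {d : Fin k → ℕ // (∀ a, 0 < d a) ∧ ∑ a, d a = t},
      {φ : Fin m → Option (Fin k × ℕ) // HasRange φ (chains d.1 : Set (Fin k × ℕ))} ×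
      {ψ : Fin n → Option (Fin k × ℕ) // HasRange ψ (chains d.1 : Set (Fin k × ℕ))}) =
      numCompositions k t * (coverCount m t * coverCount n t) := by
    intro t
    have hfib : ∀ d : {d : Fin k → ℕ // (∀ a, 0 < d a) ∧ ∑ a, d a = t}, Nat.card
      ({φ : Fin m → Option (Fin k × ℕ) // HasRange φ (chains d.1 : Set (Fin k × ℕ))} ×
      {ψ : Fin n → Option (Fin k × ℕ) // HasRange ψ (chains d.1 : Set (Fin k × ℕ))}) =
      coverCount m t * coverCount n t := by
      intro d
      rw [Nat.card_prod, card_hasRange, card_hasRange, card_chains, d.2.2, Fintype.card_fin,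
        Fintype.card_fin]
    have := Fintype.ofFinite {d : Fin k → ℕ // (∀ a, 0 < d a) ∧ ∑ a, d a = t}
    rw [Nat.card_sigma, sum_congr rfl fun d _ => hfib d, sum_const, card_univ, smul_eq_mul,
      numCompositions, Nat.card_eq_fintype_card]
  rw [Nat.card_sigma]
  exact sum_congr rfl fun t _ => inner t

end ZeroOneMatrix

/-! ### Labelled matrices are the decomposable matrices of order k -/

namespace ZeroOneMatrix

theorem natCast_val_eq_ite (x : Fin 2) : ((x : ℕ) : ℤ) = if x ≠ 0 then 1 else 0 := by
  fin_cases x <;> simp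

/-- A matrix whose ones are given by a threshold condition is lonesum. -/
theorem isLonesum_of_threshold {m n : ℕ} (A : ZeroOneMatrix (Fin m) (Fin n)) (s : Fin m → ℕ)
    (t : Fin n → ℕ) (hA : ∀ i j, A i j ≠ 0 ↔ s i ≤ t j) : A.IsLonesum := by
  intro B hrow hcol
  -- The weight is a row term plus a column term, so the weighted sum of a matrix depends only on
  -- its line sums. Being odd, it never vanishes, and it is positive exactly at the ones of `A`;
  -- hence `A` is the unique maximizer.
  set w : Fin m → Fin n → ℤ := fun i j => 2 * ((t j : ℤ) - s i) + 1 with hw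
  have hpair : ∀ C : ZeroOneMatrix (Fin m) (Fin n), ∑ i, ∑ j, ((C i j : ℕ) : ℤ) * w i j =
      2 * ∑ j, (t j : ℤ) * C.colSum j + ∑ i, (1 - 2 * (s i : ℤ)) * C.rowSum i := by
    intro C
    have h1 : ∑ j, (t j : ℤ) * C.colSum j = ∑ i, ∑ j, (t j : ℤ) * ((C i j : ℕ) : ℤ) := by
      rw [sum_comm]
      simp [colSum, mul_sum]
    have h2 : ∑ i, (1 - 2 * (s i : ℤ)) * C.rowSum i =
        ∑ i, ∑ j, (1 - 2 * (s i : ℤ)) * ((C i j : ℕ) : ℤ) := by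
      simp [rowSum, mul_sum]
    rw [h1, h2, mul_sum, ← sum_add_distrib]
    refine sum_congr rfl fun i _ => ?_
    rw [mul_sum, ← sum_add_distrib]
    refine sum_congr rfl fun j _ => ?_
    rw [hw]
    ring
  have hnonneg : ∀ i j, 0 ≤ (((A i j : ℕ) : ℤ) - (B i j : ℕ)) * w i j := by
    intro i j
    have h1 := hA i j
    simp only [natCast_val_eq_ite, hw]
    by_cases h : A i j ≠ 0
    · rw [if_pos h]
      have := h1.1 h
      refine mul_nonneg ?_ (by omega)
      split_ifs <;> norm_num
    · rw [if_neg h]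
      have : ¬ s i ≤ t j := fun h' => h (h1.2 h')
      refine mul_nonneg_of_nonpos_of_nonpos ?_ (by omega)
      split_ifs <;> norm_num
  have hsum : ∑ i, ∑ j, (((A i j : ℕ) : ℤ) - (B i j : ℕ)) * w i j = 0 := by
    simp only [sub_mul, sum_sub_distrib]
    rw [hpair A, hpair B, hrow, hcol, sub_self]
  ext i j
  have h1 := (sum_eq_zero_iff_of_nonneg fun i _ => sum_nonneg fun j _ => hnonneg i j).1 hsum i
    (mem_univ i)
  have h2 := (sum_eq_zero_iff_of_nonneg fun j _ => hnonneg i j).1 h1 j (mem_univ j)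
  rcases mul_eq_zero.1 h2 with h3 | h3
  · omega
  · simp only [hw] at h3
    omega

/-- A matrix whose ones are at positions with equal row and column colour is, up to permutations,
block diagonal. -/
theorem permEquiv_blockDiagonal' {m n : ℕ} {ι : Type} [DecidableEq ι]
    (A : ZeroOneMatrix (Fin m) (Fin n)) (ρ : Fin m → ι) (γ : Fin n → ι)
    (hA : ∀ i j, A i j ≠ 0 → ρ i = γ j) {r c : ι → ℕ} (e : ∀ o, Fin (r o) ≃ {i // ρ i = o})
    (f : ∀ o, Fin (c o) ≃ {j // γ j = o}) :
    PermEquiv A (Matrix.blockDiagonal' fun o => A.submatrix (fun x => (e o x : Fin m))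
      fun y => (f o y : Fin n)) := by
  let E := (Equiv.sigmaCongrRight e).trans (Equiv.sigmaFiberEquiv ρ)
  let F := (Equiv.sigmaCongrRight f).trans (Equiv.sigmaFiberEquiv γ)
  refine ⟨E.symm, F.symm, ?_⟩
  ext i j : 1
  obtain ⟨⟨o, x⟩, rfl⟩ := E.surjective i
  obtain ⟨⟨o', y⟩, rfl⟩ := F.surjective j
  rw [Matrix.submatrix_apply, E.symm_apply_apply, F.symm_apply_apply]
  by_cases h : o = o'
  · subst h
    rw [Matrix.blockDiagonal'_apply_eq]
    rfl
  · rw [Matrix.blockDiagonal'_apply_ne _ _ _ h]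
    by_contra h'
    have := hA _ _ h'
    exact h ((e o x).2.symm.trans (this.trans (f o' y).2))

/-- The same with a distinguished colour for zero rows and columns. -/
theorem permEquiv_fromBlocks {m n : ℕ} {ι : Type} [DecidableEq ι]
    (A : ZeroOneMatrix (Fin m) (Fin n)) (ρ : Fin m → Option ι) (γ : Fin n → Option ι)
    (hA : ∀ i j, A i j ≠ 0 → ρ i = γ j ∧ ρ i ≠ none) {r c : ι → ℕ} {a b : ℕ}
    (e : ∀ o, Fin (r o) ≃ {i // ρ i = some o}) (f : ∀ o, Fin (c o) ≃ {j // γ j = some o})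
    (e₀ : Fin a ≃ {i // ρ i = none}) (f₀ : Fin b ≃ {j // γ j = none}) :
    PermEquiv A (Matrix.fromBlocks (Matrix.blockDiagonal' fun o =>
      A.submatrix (fun x => (e o x : Fin m)) fun y => (f o y : Fin n)) 0 0
      (0 : ZeroOneMatrix (Fin a) (Fin b))) := by
  have split : ∀ {l u : ℕ} {q : ι → ℕ} (χ : Fin l → Option ι)
      (g : ∀ o, Fin (q o) ≃ {i // χ i = some o}) (g₀ : Fin u ≃ {i // χ i = none}),
      Function.Bijective (Sum.elim (fun x : Σ o, Fin (q o) => (g x.1 x.2 : Fin l))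
        fun z => (g₀ z : Fin l)) := by
    intro l u q χ g g₀
    constructor
    · rintro (⟨o, x⟩ | z) (⟨o', x'⟩ | z') h
      · simp only [Sum.elim_inl] at h
        have h1 := (g o x).2
        rw [h, (g o' x').2, Option.some.injEq] at h1
        subst h1
        rw [(g o').injective (Subtype.ext h)]
      · simp only [Sum.elim_inl, Sum.elim_inr] at h
        have h1 := (g o x).2
        rw [h, (g₀ z').2] at h1
        cases h1
      · simp only [Sum.elim_inl, Sum.elim_inr] at h
        have h1 := (g₀ z).2
        rw [h, (g o' x').2] at h1
        cases h1
      · rw [g₀.injective (Subtype.ext h)]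
    · intro i
      rcases h : χ i with _ | o
      · exact ⟨Sum.inr (g₀.symm ⟨i, h⟩), by simp⟩
      · exact ⟨Sum.inl ⟨o, (g o).symm ⟨i, h⟩⟩, by simp⟩
  let E := Equiv.ofBijective _ (split ρ e e₀)
  let F := Equiv.ofBijective _ (split γ f f₀)
  refine ⟨E.symm, F.symm, ?_⟩
  ext i j : 1
  obtain ⟨x, rfl⟩ := E.surjective i
  obtain ⟨y, rfl⟩ := F.surjective j
  rw [Matrix.submatrix_apply, E.symm_apply_apply, F.symm_apply_apply]
  rcases x with ⟨o, x⟩ | z <;> rcases y with ⟨o', y⟩ | z'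
  · rw [Matrix.fromBlocks_apply₁₁]
    by_cases h : o = o'
    · subst h
      rw [Matrix.blockDiagonal'_apply_eq]
      rfl
    · rw [Matrix.blockDiagonal'_apply_ne _ _ _ h]
      by_contra h'
      have := (hA _ _ h').1
      exact h (Option.some.inj ((e o x).2.symm.trans (this.trans (f o' y).2)))
  · by_contra h'
    have := (hA _ _ h').1.trans (f₀ z').2
    exact (hA _ _ h').2 this
  · by_contra h'
    exact (hA _ _ h').2 (e₀ z).2
  · by_contra h'
    exact (hA _ _ h').2 (e₀ z).2

theorem exists_equiv_monotone {X α : Type} [Fintype X] [LinearOrder α] (g : X → α) :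
    ∃ e : Fin (Fintype.card X) ≃ X, Monotone (g ∘ e) :=
  ⟨(Tuple.sort (g ∘ (Fintype.equivFin X).symm)).trans (Fintype.equivFin X).symm,
    Tuple.monotone_sort (g ∘ (Fintype.equivFin X).symm)⟩

/-- The position of a label on its chain. -/
def position {k : ℕ} (x : Option (Fin k × ℕ)) : ℕ := x.elim 0 Prod.snd

theorem eq_some_of_map_fst {k : ℕ} {x : Option (Fin k × ℕ)} {a : Fin k}
    (h : x.map Prod.fst = some a) : x = some (a, position x) := by
  rcases x with _ | ⟨b, s⟩
  · cases h
  · obtain rfl : b = a := Option.some.inj h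
    rfl

section Structure

variable {k m n : ℕ} {φ : Fin m → Option (Fin k × ℕ)} {ψ : Fin n → Option (Fin k × ℕ)}

theorem ofLabels_block_ne_zero {a : Fin k} {i : Fin m} {j : Fin n}
    (hi : (φ i).map Prod.fst = some a) (hj : (ψ j).map Prod.fst = some a) :
    ofLabels φ ψ i j ≠ 0 ↔ position (φ i) ≤ position (ψ j) := by
  rw [ofLabels_ne_zero]
  constructor
  · rintro ⟨b, s, t, h1, h2, h3⟩
    rw [h1, h2]
    exact h3
  · intro h
    exact ⟨a, _, _, eq_some_of_map_fst hi, eq_some_of_map_fst hj, h⟩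

theorem map_fst_eq_of_ofLabels_ne_zero {i : Fin m} {j : Fin n} (h : ofLabels φ ψ i j ≠ 0) :
    (φ i).map Prod.fst = (ψ j).map Prod.fst ∧ (φ i).map Prod.fst ≠ none := by
  obtain ⟨a, s, t, h1, h2, -⟩ := ofLabels_ne_zero.1 h
  simp [h1, h2]

/-- Each chain gives a threshold block, hence a lonesum one; the unlabelled lines form one extra
block, which is zero. -/
theorem isLonesumDecomposable_ofLabels (φ : Fin m → Option (Fin k × ℕ))
    (ψ : Fin n → Option (Fin k × ℕ)) : (ofLabels φ ψ).IsLonesumDecomposable := by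
  classical
  let ρ : Fin m → Fin (k + 1) := fun i => (finSuccEquiv k).symm ((φ i).map Prod.fst)
  let γ : Fin n → Fin (k + 1) := fun j => (finSuccEquiv k).symm ((ψ j).map Prod.fst)
  have hρ : ∀ i o, ρ i = o ↔ (φ i).map Prod.fst = finSuccEquiv k o := fun i o =>
    Equiv.symm_apply_eq _
  have hγ : ∀ j o, γ j = o ↔ (ψ j).map Prod.fst = finSuccEquiv k o := fun j o =>
    Equiv.symm_apply_eq _
  refine ⟨k + 1, _, _, _, fun o => ?_, permEquiv_blockDiagonal' _ ρ γ
    (fun i j h => congrArg (finSuccEquiv k).symm (map_fst_eq_of_ofLabels_ne_zero h).1)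
    (fun o => (Fintype.equivFin _).symm) (fun o => (Fintype.equivFin _).symm)⟩
  rcases ho : finSuccEquiv k o with _ | a
  -- The constants 1 and 0 give a threshold that is never met, as suits a zero block.
  · refine isLonesum_of_threshold _ (fun _ => 1) (fun _ => 0) fun x y =>
      iff_of_false (fun h => ?_) (by norm_num)
    exact (map_fst_eq_of_ofLabels_ne_zero h).2
      (((hρ _ _).1 ((Fintype.equivFin {i // ρ i = o}).symm x).2).trans ho)
  · exact isLonesum_of_threshold _
      (fun x => position (φ ((Fintype.equivFin {i // ρ i = o}).symm x)))
      (fun y => position (ψ ((Fintype.equivFin {j // γ j = o}).symm y)))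
      fun x y => ofLabels_block_ne_zero
        (((hρ _ _).1 ((Fintype.equivFin {i // ρ i = o}).symm x).2).trans ho)
        (((hγ _ _).1 ((Fintype.equivFin {j // γ j = o}).symm y).2).trans ho)

theorem IsLabelling.hasDecompositionOrder (h : IsLabelling φ ψ) :
    (ofLabels φ ψ).HasDecompositionOrder k := by
  classical
  have hrow := fun a : Fin k => exists_equiv_monotone
    fun i : {i // (φ i).map Prod.fst = some a} => position (φ i)
  -- Ones sit where row position ≤ column position, so the Ferrers shape requires rows in increasing
  -- and columns in decreasing order of position.
  have hcol := fun a : Fin k => exists_equiv_monotone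
    fun j : {j // (ψ j).map Prod.fst = some a} => OrderDual.toDual (position (ψ j))
  choose e he using hrow
  choose f hf using hcol
  have hmem : ∀ a x y, ofLabels φ ψ (e a x) (f a y) ≠ 0 ↔
      position (φ (e a x)) ≤ position (ψ (f a y)) := fun a x y =>
    ofLabels_block_ne_zero (e a x).2 (f a y).2
  have hmem' : ∀ a x y, ofLabels φ ψ (e a x) (f a y) = 0 ↔
      ¬ position (φ (e a x)) ≤ position (ψ (f a y)) := fun a x y => by
    rw [← hmem, not_not]
  refine ⟨_, _, _, _, _, fun a => ⟨?_, ?_, ⟨?_, ?_⟩, ?_, ?_⟩, permEquiv_fromBlocks _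
    (fun i => (φ i).map Prod.fst) (fun j => (ψ j).map Prod.fst)
    (fun i j h => map_fst_eq_of_ofLabels_ne_zero h) e f
    (Fintype.equivFin _).symm (Fintype.equivFin _).symm⟩
  · obtain ⟨i, hi⟩ := h.exists_row_of_block a
    exact Fintype.card_pos_iff.2 ⟨⟨i, by simp [hi]⟩⟩
  · obtain ⟨i, hi⟩ := h.exists_row_of_block a
    obtain ⟨j, hj⟩ := h.exists_col hi
    exact Fintype.card_pos_iff.2 ⟨⟨j, by simp [hj]⟩⟩
  · intro x x' y hx h0
    have h1 : position (φ (e a x)) ≤ position (φ (e a x')) := he a hx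
    have h2 := (hmem' a x y).1 h0
    exact (hmem' a x' y).2 (by omega)
  · intro x y y' hy h0
    have h1 : position (ψ (f a y')) ≤ position (ψ (f a y)) := hf a hy
    have h2 := (hmem' a x y).1 h0
    exact (hmem' a x y').2 (by omega)
  · intro x
    have hx := eq_some_of_map_fst (e a x).2
    obtain ⟨j, hj⟩ := h.exists_col hx
    refine ⟨(f a).symm ⟨j, by simp [hj]⟩, ?_⟩
    rw [Matrix.submatrix_apply, hmem, Equiv.apply_symm_apply, hj]
    exact le_rfl
  · intro y
    have hy := eq_some_of_map_fst (f a y).2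
    obtain ⟨i, hi⟩ := h.exists_row hy
    refine ⟨(e a).symm ⟨i, by simp [hi]⟩, ?_⟩
    rw [Matrix.submatrix_apply, hmem, Equiv.apply_symm_apply, hi]
    exact le_rfl

end Structure

/-- The rows of a Ferrers matrix are initial segments. -/
theorem IsFerrers.ne_zero_iff {r c : ℕ} {F : ZeroOneMatrix (Fin r) (Fin c)} (h : F.IsFerrers)
    (i : Fin r) (j : Fin c) : F i j ≠ 0 ↔ (j : ℕ) < #{j' | F i j' ≠ 0} := by
  have hlow : ∀ j j', j ≤ j' → F i j' ≠ 0 → F i j ≠ 0 := fun j j' hj h1 h2 => h1 (h.2 i j j' hj h2)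
  constructor
  · intro h1
    have : Finset.Iic j ⊆ ({j' | F i j' ≠ 0} : Finset (Fin c)) := fun j' hj' =>
      mem_filter.2 ⟨mem_univ _, hlow _ _ (mem_Iic.1 hj') h1⟩
    have := card_le_card this
    rw [Fin.card_Iic] at this
    omega
  · intro h1 h2
    have : ({j' | F i j' ≠ 0} : Finset (Fin c)) ⊆ Finset.Iio j := fun j' hj' =>
      mem_Iio.2 (lt_of_not_ge fun h3 => hlow _ _ h3 (mem_filter.1 hj').2 h2)
    have := card_le_card this
    rw [Fin.card_Iio] at this
    omega

/-- Numbering the elements of a finite set in decreasing order. -/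
theorem exists_card_lt_eq (D : Finset ℕ) {s : ℕ} (hs : s < #D) :
    ∃ v ∈ D, #{u ∈ D | v < u} = s := by
  have hmaps : ∀ v ∈ D, #{u ∈ D | v < u} ∈ range #D := fun v hv => by
    rw [mem_range]
    refine card_lt_card (filter_ssubset.2 ⟨v, hv, lt_irrefl v⟩)
  have hinj : ∀ v ∈ D, ∀ w ∈ D, #{u ∈ D | v < u} = #{u ∈ D | w < u} → v = w := by
    have key : ∀ v ∈ D, ∀ w ∈ D, v < w → #{u ∈ D | w < u} < #{u ∈ D | v < u} := by
      intro v _ w hw hvw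
      refine card_lt_card ((ssubset_iff_of_subset fun u hu => ?_).2 ⟨w, ?_, ?_⟩)
      · rw [mem_filter] at hu ⊢
        exact ⟨hu.1, hvw.trans hu.2⟩
      · exact mem_filter.2 ⟨hw, hvw⟩
      · simp
    intro v hv w hw h
    rcases lt_trichotomy v w with h1 | h1 | h1
    · exact absurd h (key v hv w hw h1).ne'
    · exact h1
    · exact absurd h (key w hw v hv h1).ne
  have himg : D.image (fun v => #{u ∈ D | v < u}) = range #D :=
    eq_of_subset_of_card_le (fun x hx => by
      obtain ⟨v, hv, rfl⟩ := mem_image.1 hx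
      exact hmaps v hv) (by
      rw [card_image_of_injOn fun v hv w hw h => hinj v hv w hw h, card_range])
  rw [← mem_range, ← himg, mem_image] at hs
  exact hs

/-- A Ferrers matrix without zero rows and columns is a staircase with repeated rows and
columns. -/
theorem IsFerrers.exists_staircase {r c : ℕ} {F : ZeroOneMatrix (Fin r) (Fin c)}
    (h : F.IsFerrers) (h0 : F.NoZeroLines) (hr : 0 < r) :
    ∃ (d : ℕ) (s : Fin r → ℕ) (t : Fin c → ℕ), 0 < d ∧ (∀ x, (∃ i, s i = x) ↔ x < d) ∧
      (∀ x, (∃ j, t j = x) ↔ x < d) ∧ ∀ i j, F i j ≠ 0 ↔ s i ≤ t j := by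
  classical
  set l : Fin r → ℕ := fun i => #{j | F i j ≠ 0} with hl
  have hF : ∀ i j, F i j ≠ 0 ↔ (j : ℕ) < l i := h.ne_zero_iff
  set D : Finset ℕ := univ.image l with hD
  have hlD : ∀ i, l i ∈ D := fun i => mem_image_of_mem _ (mem_univ i)
  have hpos : ∀ j : Fin c, 0 < #{u ∈ D | (j : ℕ) < u} := fun j => by
    obtain ⟨i, hi⟩ := h0.2 j
    exact card_pos.2 ⟨l i, mem_filter.2 ⟨hlD i, (hF i j).1 hi⟩⟩
  -- `D` is the set of row lengths. A row is labelled by the number of lengths exceeding its own; a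
  -- column j, by the number exceeding j, less one. That number is positive since column j is not
  -- zero.
  refine ⟨#D, fun i => #{u ∈ D | l i < u}, fun j => #{u ∈ D | (j : ℕ) < u} - 1,
    card_pos.2 ⟨_, hlD ⟨0, hr⟩⟩, fun x => ⟨?_, fun hx => ?_⟩, fun x => ⟨?_, fun hx => ?_⟩,
    fun i j => ?_⟩
  · rintro ⟨i, rfl⟩
    exact card_lt_card (filter_ssubset.2 ⟨l i, hlD i, lt_irrefl _⟩)
  · obtain ⟨v, hv, rfl⟩ := exists_card_lt_eq D hx
    obtain ⟨i, -, rfl⟩ := mem_image.1 hv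
    exact ⟨i, rfl⟩
  · rintro ⟨j, rfl⟩
    have := hpos j
    have := card_le_card (filter_subset (fun u => (j : ℕ) < u) D)
    show #{u ∈ D | (j : ℕ) < u} - 1 < #D
    omega
  · obtain ⟨v, hv, rfl⟩ := exists_card_lt_eq D hx
    obtain ⟨i, -, rfl⟩ := mem_image.1 hv
    obtain ⟨j₀, hj₀⟩ := h0.1 i
    have h1 := (hF i j₀).1 hj₀
    have h2 : l i ≤ c := (card_le_univ _).trans (by simp)
    -- The last column in the support of row i: one more length, `l i` itself, exceeds its index,
    -- which offsets the subtracted one.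
    refine ⟨⟨l i - 1, by omega⟩, ?_⟩
    have h3 : ({u ∈ D | l i - 1 < u} : Finset ℕ) = insert (l i) {u ∈ D | l i < u} := by
      ext u
      simp only [mem_filter, mem_insert]
      constructor
      · rintro ⟨h4, h5⟩
        by_cases h6 : u = l i
        · exact Or.inl h6
        · exact Or.inr ⟨h4, by omega⟩
      · rintro (rfl | ⟨h4, h5⟩)
        · exact ⟨hlD i, by omega⟩
        · exact ⟨h4, by omega⟩
    simp only [h3]
    rw [card_insert_of_notMem (by simp), Nat.add_sub_cancel]
  · rw [hF]
    have hp := hpos j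
    constructor
    · intro h1
      have : #{u ∈ D | l i < u} < #{u ∈ D | (j : ℕ) < u} := by
        refine card_lt_card ((ssubset_iff_of_subset fun u hu => ?_).2 ⟨l i, ?_, by simp⟩)
        · rw [mem_filter] at hu ⊢
          exact ⟨hu.1, h1.trans hu.2⟩
        · exact mem_filter.2 ⟨hlD i, h1⟩
      show #{u ∈ D | l i < u} ≤ #{u ∈ D | (j : ℕ) < u} - 1
      omega
    · intro (h1 : #{u ∈ D | l i < u} ≤ #{u ∈ D | (j : ℕ) < u} - 1)
      by_contra h2
      have : #{u ∈ D | (j : ℕ) < u} ≤ #{u ∈ D | l i < u} := by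
        refine card_le_card fun u hu => ?_
        rw [mem_filter] at hu ⊢
        exact ⟨hu.1, by omega⟩
      omega

/-- The staircase labels of the Ferrers blocks are glued together, with one chain per block and
`none` on the zero lines. -/
theorem HasDecompositionOrder.exists_labelling {k m n : ℕ} {A : ZeroOneMatrix (Fin m) (Fin n)}
    (h : A.HasDecompositionOrder k) : ∃ x : Labelling k m n, ofLabels x.1.1 x.1.2 = A := by
  obtain ⟨r, c, a, b, F, hF, e, f, rfl⟩ := h
  have hst := fun o => (hF o).2.2.1.exists_staircase (hF o).2.2.2 (hF o).1
  choose d s t hd hs ht hst using hst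
  let φ : Fin m → Option (Fin k × ℕ) := fun i =>
    (e i).elim (fun x => some (x.1, s x.1 x.2)) fun _ => none
  let ψ : Fin n → Option (Fin k × ℕ) := fun j =>
    (f j).elim (fun y => some (y.1, t y.1 y.2)) fun _ => none
  have hrange : ∀ {l u : ℕ} {q : Fin k → ℕ} (g : Fin l ≃ (Σ o, Fin (q o)) ⊕ Fin u)
      (v : ∀ o, Fin (q o) → ℕ), (∀ o x, (∃ i, v o i = x) ↔ x < d o) →
      HasRange (fun i => (g i).elim (fun x => some (x.1, v x.1 x.2)) fun _ => none)
        (chains d : Set (Fin k × ℕ)) := by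
    rintro l u q g v hv ⟨o, x⟩
    rw [mem_coe, mem_chains]
    show _ ↔ x < d o
    rw [← hv]
    constructor
    · rintro ⟨i, hi⟩
      rcases hg : g i with ⟨o', y⟩ | z
      · simp only [hg, Sum.elim_inl, Option.some.injEq, Prod.mk.injEq] at hi
        obtain ⟨rfl, rfl⟩ := hi
        exact ⟨y, rfl⟩
      · simp [hg] at hi
    · rintro ⟨y, rfl⟩
      exact ⟨g.symm (Sum.inl ⟨o, y⟩), by simp⟩
  refine ⟨⟨(φ, ψ), d, hd, hrange e s hs, hrange f t ht⟩, ext_of_ne_zero fun i j => ?_⟩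
  rw [ofLabels_ne_zero, Matrix.submatrix_apply]
  show (∃ a s' t', (e i).elim (fun x => some (x.1, s x.1 x.2)) (fun _ => none) = some (a, s') ∧
    (f j).elim (fun y => some (y.1, t y.1 y.2)) (fun _ => none) = some (a, t') ∧ s' ≤ t') ↔ _
  rcases e i with ⟨o, x⟩ | z <;> rcases f j with ⟨o', y⟩ | z'
  · rw [Matrix.fromBlocks_apply₁₁]
    by_cases h : o = o'
    · subst h
      rw [Matrix.blockDiagonal'_apply_eq, hst]
      simp
    · rw [Matrix.blockDiagonal'_apply_ne _ _ _ h]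
      simp [Ne.symm h]
  · simp
  · simp
  · simp

end ZeroOneMatrix

/-! ### The counting formula and the congruences -/

/-- The number of lonesum decomposable matrices of given decomposition order. -/
theorem factorial_mul_lonesumD (k m n N : ℕ) (hN : m < N) :
    k.factorial * lonesumD k m n =
      ∑ t ∈ range N, ZeroOneMatrix.numCompositions k t * (coverCount m t * coverCount n t) := by
  rw [← ZeroOneMatrix.card_labelling k m n N hN, ZeroOneMatrix.card_labelling_eq_factorial_mul]
  congr 1
  -- Having order k already yields a labelling, and a labelling yields both conditions.
  refine Nat.card_congr (Equiv.subtypeEquivRight fun A => ⟨fun h => h.2.exists_labelling, ?_⟩)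
  rintro ⟨x, rfl⟩
  exact ⟨ZeroOneMatrix.isLonesumDecomposable_ofLabels _ _, x.2.hasDecompositionOrder⟩

theorem numCompositions_eq_zero_of_lt {k t : ℕ} (h : t < k) :
    ZeroOneMatrix.numCompositions k t = 0 := by
  have : IsEmpty {d : Fin k → ℕ // (∀ a, 0 < d a) ∧ ∑ a, d a = t} := by
    refine ⟨fun d => ?_⟩
    have h1 : ∑ _a : Fin k, 1 ≤ ∑ a, d.1 a := sum_le_sum fun a _ => d.2.1 a
    rw [d.2.2] at h1
    simp at h1
    omega
  exact Nat.card_of_isEmpty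

theorem numCompositions_eq_choose {k t : ℕ} (hk : 0 < k) (h : k ≤ t) :
    ZeroOneMatrix.numCompositions k t = (t - 1).choose (k - 1) := by
  have h1 := card_pos_sum_eq k (t - k)
  rw [Nat.sub_add_cancel h, show k + (t - k) - 1 = t - 1 by omega] at h1
  rw [ZeroOneMatrix.numCompositions, h1]
  exact Nat.choose_symm_of_eq_add (by omega)

section ModPrime

variable {p : ℕ} [Fact p.Prime]

/-- Terms with t < k vanish and the others contain (t!)², so (k!)² divides k! · D_k, and one k!
cancels. -/
theorem factorial_dvd_lonesumD (k m n : ℕ) : k.factorial ∣ lonesumD k m n := by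
  have h : k.factorial * k.factorial ∣ k.factorial * lonesumD k m n := by
    rw [factorial_mul_lonesumD k m n (m + 1) m.lt_succ_self]
    refine dvd_sum fun t _ => ?_
    rcases lt_or_ge t k with ht | ht
    · rw [numCompositions_eq_zero_of_lt ht, zero_mul]
      exact dvd_zero _
    · exact Dvd.dvd.mul_left (mul_dvd_mul
        ((Nat.factorial_dvd_factorial ht).trans (factorial_dvd_coverCount m t))
        ((Nat.factorial_dvd_factorial ht).trans (factorial_dvd_coverCount n t))) _
  exact Nat.dvd_of_mul_dvd_mul_left k.factorial_pos h

theorem lonesumD_modEq_zero {k : ℕ} (m n : ℕ) (h : p ≤ k) : lonesumD k m n ≡ 0 [MOD p] :=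
  Nat.modEq_zero_iff_dvd.2
    ((((Fact.out : p.Prime).dvd_factorial).2 h).trans (factorial_dvd_lonesumD k m n))

/-- Terms with t ≥ p vanish because p ∣ t!, so the range of summation no longer depends on `m`. -/
theorem cast_factorial_mul_lonesumD (k m n : ℕ) :
    (k.factorial : ZMod p) * lonesumD k m n = ∑ t ∈ range p,
      (ZeroOneMatrix.numCompositions k t : ZMod p) * (coverCount m t * coverCount n t) := by
  have h := congrArg (Nat.cast : ℕ → ZMod p)
    (factorial_mul_lonesumD k m n (m + p + 1) (by omega))
  push_cast at h
  rw [h]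
  refine (sum_subset (range_subset_range.2 (by omega)) fun t _ ht => ?_).symm
  rw [mem_range, not_lt] at ht
  rw [cast_coverCount_eq_zero m ht, zero_mul, mul_zero]

theorem cast_factorial_ne_zero {k : ℕ} (h : k < p) : (k.factorial : ZMod p) ≠ 0 := by
  rw [Ne, ZMod.natCast_eq_zero_iff, (Fact.out : p.Prime).dvd_factorial]
  omega

theorem lonesumD_congr (k : ℕ) {m m' n n' : ℕ} (hm : 0 < m) (hm' : 0 < m') (hn : 0 < n)
    (hn' : 0 < n') (h : m ≡ m' [MOD (p - 1)]) (h' : n ≡ n' [MOD (p - 1)]) :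
    lonesumD k m n ≡ lonesumD k m' n' [MOD p] := by
  rcases le_or_gt p k with hk | hk
  · exact (lonesumD_modEq_zero m n hk).trans (lonesumD_modEq_zero m' n' hk).symm
  · rw [← ZMod.natCast_eq_natCast_iff]
    refine mul_left_cancel₀ (cast_factorial_ne_zero hk) ?_
    simp only [cast_factorial_mul_lonesumD, cast_coverCount_congr hm hm' h,
      cast_coverCount_congr hn hn' h']

theorem cast_lonesumD_pred {k n : ℕ} (hk : 0 < k) (hn : 0 < n) (h : k < p) :
    (lonesumD k (p - 1) n : ZMod p) =
      if p - 1 ∣ n then (-1) ^ (k - 1) / ((k - 1).factorial : ZMod p) else 0 := by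
  have hp := (Fact.out : p.Prime).two_le
  have hf := cast_factorial_ne_zero h
  refine mul_left_cancel₀ hf ?_
  -- At t = p - 1 the coefficient C(p-2,k-1) is (-1)^(k-1) k, and this k turns k! into (k-1)!. The
  -- two range counts are -1 and, according to whether p - 1 ∣ n, -1 or 0.
  rw [cast_factorial_mul_lonesumD, sum_eq_single (p - 1)]
  · rw [numCompositions_eq_choose hk (by omega), show p - 1 - 1 = p - 2 by omega,
      cast_choose_pred_pred (by omega), cast_coverCount_pred_right (by omega),
      cast_coverCount_pred_right hn, if_pos dvd_rfl]
    obtain ⟨k, rfl⟩ := Nat.exists_eq_add_of_le' hk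
    rw [Nat.factorial_succ] at hf ⊢
    push_cast at hf ⊢
    have := right_ne_zero_of_mul hf
    split_ifs
    · field_simp
    · simp
  · intro t ht hne
    rw [mem_range] at ht
    rcases Nat.eq_zero_or_pos t with rfl | h0
    · rw [numCompositions_eq_zero_of_lt hk, Nat.cast_zero, zero_mul]
    · rw [cast_coverCount_pred h0 (by omega), zero_mul, mul_zero]
  · intro hnot
    exact absurd (mem_range.2 (by omega)) hnot

end ModPrime

theorem lonesumD_one_left (k n : ℕ) (hk : 2 ≤ k) : lonesumD k 1 n = 0 := by
  have h := factorial_mul_lonesumD k 1 n 2 one_lt_two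
  rw [sum_range_succ, sum_range_one, numCompositions_eq_zero_of_lt (by omega),
    numCompositions_eq_zero_of_lt (by omega)] at h
  have := k.factorial_ne_zero
  simp_all

theorem lonesumD_one_one (n : ℕ) : lonesumD 1 1 n + 1 = 2 ^ n := by
  have h := factorial_mul_lonesumD 1 1 n 2 one_lt_two
  have h1 := sum_choose_mul_coverCount n 1
  have h2 := sum_choose_mul_coverCount n 0
  have h3 : coverCount 1 1 = 1 := by simp [coverCount, Nat.stirlingSecond_self]
  rw [sum_range_succ, sum_range_one, numCompositions_eq_zero_of_lt one_pos,
    numCompositions_eq_choose one_pos le_rfl, h3] at h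
  simp [sum_range_succ] at h h1 h2
  omega

theorem theorem4p3 (p : ℕ) [Fact p.Prime] (k m m' n n' : ℕ)
    (hk : 0 < k) (hm : 0 < m) (hm' : 0 < m') (hn : 0 < n) (hn' : 0 < n') :
    (p ≤ k → lonesumD k m n ≡ 0 [MOD p]) ∧
    (m ≡ m' [MOD (p - 1)] → n ≡ n' [MOD (p - 1)] →
      lonesumD k m n ≡ lonesumD k m' n' [MOD p]) ∧
    (k < p →
      (¬ n ≡ 0 [MOD (p - 1)] → lonesumD k (p - 1) n ≡ 0 [MOD p]) ∧
      (n ≡ 0 [MOD (p - 1)] →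
        (lonesumD k (p - 1) n : ZMod p) = (-1) ^ (k - 1) / ((k - 1).factorial : ZMod p))) ∧
    ((k = 1 → (lonesumD k p n : ℤ) ≡ 2 ^ n - 1 [ZMOD (p : ℤ)]) ∧
      (2 ≤ k → lonesumD k p n ≡ 0 [MOD p])) := by
  have hp := (Fact.out : p.Prime).two_le
  -- Since p ≡ 1 modulo p - 1, the last part reduces to matrices with a single row.
  have hone : lonesumD k p n ≡ lonesumD k 1 n [MOD p] := by
    refine lonesumD_congr k (by omega) one_pos hn hn ?_ rfl
    obtain ⟨q, rfl⟩ := Nat.exists_eq_add_of_le' (show 1 ≤ p by omega)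
    simp [Nat.ModEq]
  refine ⟨lonesumD_modEq_zero m n, lonesumD_congr k hm hm' hn hn', fun h => ⟨fun hd => ?_,
    fun hd => ?_⟩, ?_, fun h => ?_⟩
  · rw [Nat.modEq_zero_iff_dvd] at hd ⊢
    rw [← ZMod.natCast_eq_zero_iff, cast_lonesumD_pred hk hn h, if_neg hd]
  · rw [Nat.modEq_zero_iff_dvd] at hd
    rw [cast_lonesumD_pred hk hn h, if_pos hd]
  · rintro rfl
    have h1 : (2 : ℤ) ^ n - 1 = (lonesumD 1 1 n : ℕ) := by
      have := lonesumD_one_one n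
      zify at this
      linarith
    rw [h1]
    exact Int.natCast_modEq_iff.2 hone
  · rwa [lonesumD_one_left k n h] at hone
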